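/- Let $g,\ell$ be positive integers and let $p=\sum_\gamma p_\gamma\gamma$ ($p_\gamma\in\mathbb C^{\ell\times\ell}$, finite sum over words $\gamma$ in $x_1,\dots,x_g$) be a free matrix polynomial which is symmetric, i.e. $p^*=p$, where $(\sum_\gamma B_\gamma\gamma)^*=\sum_\gamma B_\gamma^*\gamma^*$ and $\gamma^*$ is the reversed word. Suppose that $p$ is archimedean: there are a real $K>0$ and finitely many matrix polynomials $s_i$ (with one column and arbitrarily many rows) and $f_i$ (of size $\ell\times 1$) such that $$K^2-\sum_{j=1}^g x_j^2=\sum_i s_i^*s_i+\sum_i f_i^*\,p\,f_i .$$ Let $\mathbb S_n^g$ be the set of $g$-tuples of self-adjoint complex $n\times n$ matrices, normed by $\|X\|^2=\sum_j\|X_j\|^2$. For a tuple $X$ put $p(X)=\sum_\gamma p_\gamma\otimes X^\gamma$, and let $D_p(n)=\{X\in\mathbb S_n^g: p(X)\succeq 0\}$. * The matrix convex hull $\mathrm{co}^{\rm mat}D_p=(\mathrm{co}^{\rm mat}D_p(n))_n$ is the smallest sequence of sets $\Gamma(n)\subseteq\mathbb S_n^g$ which contains $(D_p(n))_n$ and is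 closed under direct sums and under conjugations $X\mapsto V^*XV=(V^*X_1V,\dots,V^*X_gV)$ by isometries $V:\mathbb C^m\to\mathbb C^n$. * Fix a separable infinite-dimensional complex Hilbert space $\mathscr K$. The operator convex hull $\mathrm{co}^{\rm oper}D_p=(\mathrm{co}^{\rm oper}D_p(n))_n$ is given by: $X\in\mathbb S_n^g$ lies in $\mathrm{co}^{\rm oper}D_p(n)$ if and only if there are a closed subspace $H$ of $\mathscr K$, a $g$-tuple $Z$ of bounded self-adjoint operators on $H$ with $p(Z)=\sum_\gamma p_\gamma\otimes Z^\gamma\succeq 0$ on $\mathbb C^\ell\otimes H$, and an isometry $V:\mathbb C^n\to H$, such that $X=V^*ZV$. * $L_p(n)$ is the set of families $Y=(Y_\alpha)_\alpha$ of complex $n\times n$ matrices, indexed by all words $\alpha$ in $x_1,\dots,x_g$, with $Y_\emptyset=I$ and $Y_{\alpha^*}=Y_\alpha^*$ for all $\alpha$, for which the infinite block matrices $$H(Y)=\big(Y_{\alpha^*\beta}\big)_{\alpha,\beta}\qquad\text{and}\qquad H_p(Y)=\Big(\sum_\gamma p_\gamma\otimes Y_{\alpha^*\gamma\beta}\Big)_{\alpha,\beta}$$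 are positive semidefinite, i.e. have nonnegative quadratic form on finitely supported vectors. Let $\hat L_p(n)=\{(Y_{x_1},\dots,Y_{x_g}): Y\in L_p(n)\}$. Then, for every positive integer $n$, $$\mathrm{co}^{\rm oper}D_p(n)=\hat L_p(n),$$ and moreover $\mathrm{co}^{\rm oper}D_p(n)$ is closed and bounded in $\mathbb S_n^g$ and contains $\mathrm{co}^{\rm mat}D_p(n)$. -/

import Mathlib

open scoped ComplexOrder Matrix

noncomputable section

namespace FreeLasserre

/-! ### Words, free polynomials, free matrix polynomials -/

/-- The monoid `⟨x⟩` of words in the letters `x₁, …, x_g`. The instance `Star (FreeMonoid _)` of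
Mathlib is reversal of words, which is the involution `w ↦ w*` (it fixes the letters). -/
abbrev Word (g : ℕ) := FreeMonoid (Fin g)

/-- Free polynomials `ℂ⟨x⟩`: the monoid algebra of the word monoid. -/
abbrev FreePoly (g : ℕ) := MonoidAlgebra ℂ (Word g)

/-- The variable `x_j`. -/
def var {g : ℕ} (j : Fin g) : FreePoly g := MonoidAlgebra.single (FreeMonoid.of j) 1

/-- The involution `∑ c_w w ↦ ∑ conj(c_w) w*` on `ℂ⟨x⟩`. -/
def adj {g : ℕ} (f : FreePoly g) : FreePoly g :=
  f.coeff.sum fun w c => MonoidAlgebra.single (star w) (star c)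

/-- `ℓ × ν` matrices with entries in `ℂ⟨x⟩`. -/
abbrev MatPoly (g ℓ ν : ℕ) := Matrix (Fin ℓ) (Fin ν) (FreePoly g)

/-- The involution on matrix polynomials, `(∑ B_w w)* = ∑ B_w* w*`. -/
def matAdj {g ℓ ν : ℕ} (P : MatPoly g ℓ ν) : MatPoly g ν ℓ := (P.map adj)ᵀ

/-- A square matrix polynomial is symmetric if `P* = P`. -/
def IsSymmetricPoly {g ℓ : ℕ} (P : MatPoly g ℓ ℓ) : Prop := matAdj P = P

/-- The polynomial `p` is archimedean: for some real `K > 0`,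
`K² - ∑ x_j² = ∑ s_i* s_i + ∑ f_i* p f_i` for finitely many matrix polynomials `s_i`, `f_i`
(an identity of `1 × 1` matrix polynomials, the row numbers of the `s_i` being arbitrary). -/
def IsArchimedean {g ℓ : ℕ} (p : MatPoly g ℓ ℓ) : Prop :=
  ∃ K : ℝ, 0 < K ∧
    ∃ (r q : ℕ) (t : Fin r → ℕ) (s : (i : Fin r) → MatPoly g (t i) 1) (f : Fin q → MatPoly g ℓ 1),
      (Matrix.of fun _ _ => algebraMap ℂ (FreePoly g) ((K : ℂ) ^ 2) - ∑ j : Fin g, var j ^ 2 :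
          MatPoly g 1 1) =
        ∑ i, matAdj (s i) * s i + ∑ i, matAdj (f i) * p * f i

/-! ### Evaluation -/

/-- The evaluation `f ↦ f(X)` of free polynomials at a tuple in a complex algebra: replace `x_j` by
`X j` and the empty word by `1`. -/
def evalHom {g : ℕ} {A : Type*} [Ring A] [Algebra ℂ A] (X : Fin g → A) : FreePoly g →ₐ[ℂ] A :=
  MonoidAlgebra.lift ℂ A (Word g) (FreeMonoid.lift X)

/-- `p(X) = ∑ p_w ⊗ w(X)` at a tuple of `n × n` matrices, as a matrix on `ℂ^ℓ ⊗ ℂ^n`. -/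
def evalMat {g ℓ n : ℕ} (p : MatPoly g ℓ ℓ) (X : Fin g → Matrix (Fin n) (Fin n) ℂ) :
    Matrix (Fin ℓ × Fin n) (Fin ℓ × Fin n) ℂ :=
  Matrix.of fun a b => evalHom X (p a.1 b.1) a.2 b.2

section Operators

variable {H : Type*} [NormedAddCommGroup H] [InnerProductSpace ℂ H]

/-- The operator on the Hilbert space direct sum `H^ℓ = ℂ^ℓ ⊗ H` given by an `ℓ × ℓ` matrix of
bounded operators: `(A v)_i = ∑_j A_{ij} v_j`. -/
def opOfMatrix {ℓ : ℕ} (A : Matrix (Fin ℓ) (Fin ℓ) (H →L[ℂ] H)) :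
    PiLp 2 (fun _ : Fin ℓ => H) →L[ℂ] PiLp 2 (fun _ : Fin ℓ => H) :=
  (PiLp.continuousLinearEquiv 2 ℂ (fun _ : Fin ℓ => H)).symm.toContinuousLinearMap ∘L
    ContinuousLinearMap.pi fun i => ∑ j, A i j ∘L PiLp.proj 2 (fun _ : Fin ℓ => H) j

/-- `p(Z) = ∑ p_w ⊗ w(Z)` at a tuple of bounded operators on `H`, acting on `ℂ^ℓ ⊗ H = H^ℓ`. -/
def evalOp {g ℓ : ℕ} (p : MatPoly g ℓ ℓ) (Z : Fin g → H →L[ℂ] H) :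
    PiLp 2 (fun _ : Fin ℓ => H) →L[ℂ] PiLp 2 (fun _ : Fin ℓ => H) :=
  opOfMatrix (p.map (evalHom Z))

end Operators

/-! ### Free semialgebraic sets and hulls -/

/-- `g`-tuples of `n × n` complex matrices. -/
abbrev Tuple (g n : ℕ) := Fin g → Matrix (Fin n) (Fin n) ℂ

/-- `𝕊_n^g`, the `g`-tuples of self-adjoint `n × n` matrices. -/
def hermTuples (g n : ℕ) : Set (Tuple g n) := {X | ∀ j, (X j).IsHermitian}

/-- The norm `‖X‖ = (∑ ‖X_j‖²)^{1/2}` on tuples, where `‖X_j‖` is the operator norm. -/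
def tupleNorm {g n : ℕ} (X : Tuple g n) : ℝ :=
  √(∑ j, ‖Matrix.toEuclideanCLM (n := Fin n) (𝕜 := ℂ) (X j)‖ ^ 2)

/-- A set of tuples of a fixed size is bounded. -/
def IsBoundedSet {g n : ℕ} (S : Set (Tuple g n)) : Prop :=
  ∃ C : ℝ, ∀ X ∈ S, tupleNorm X ≤ C

/-- `D_p(n) = {X ∈ 𝕊_n^g : p(X) ⪰ 0}`. -/
def semialg {g ℓ : ℕ} (p : MatPoly g ℓ ℓ) (n : ℕ) : Set (Tuple g n) :=
  {X | X ∈ hermTuples g n ∧ (evalMat p X).PosSemidef}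

/-- The direct sum of two tuples. -/
def directSum {g n m : ℕ} (A : Tuple g n) (B : Tuple g m) : Tuple g (n + m) := fun j =>
  Matrix.reindex finSumFinEquiv finSumFinEquiv (Matrix.fromBlocks (A j) 0 0 (B j))

/-- `V* A V`. -/
def conjBy {g n m : ℕ} (V : Matrix (Fin n) (Fin m) ℂ) (A : Tuple g n) : Tuple g m :=
  fun j => Vᴴ * A j * V

/-- A matrix convex set: a sequence of subsets `Γ(n) ⊆ 𝕊_n^g` closed under direct sums and under
simultaneous conjugation by isometries. -/
structure IsMatrixConvex {g : ℕ} (Γ : (n : ℕ) → Set (Tuple g n)) : Prop where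
  subset_herm : ∀ n, Γ n ⊆ hermTuples g n
  directSum_mem : ∀ {n m : ℕ} (A : Tuple g n) (B : Tuple g m),
    A ∈ Γ n → B ∈ Γ m → directSum A B ∈ Γ (n + m)
  conj_mem : ∀ {n m : ℕ} (A : Tuple g n) (V : Matrix (Fin n) (Fin m) ℂ),
    A ∈ Γ n → Vᴴ * V = 1 → conjBy V A ∈ Γ m

/-- The matrix convex hull of `Γ`: the smallest matrix convex set containing `Γ`. -/
def matHull {g : ℕ} (Γ : (n : ℕ) → Set (Tuple g n)) (n : ℕ) : Set (Tuple g n) :=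
  {X | ∀ Δ : (m : ℕ) → Set (Tuple g m), IsMatrixConvex Δ → (∀ m, Γ m ⊆ Δ m) → X ∈ Δ n}

/-- `D_p^∞(H)`: the `g`-tuples `Z` of bounded self-adjoint operators on the Hilbert space `H`
with `p(Z) ⪰ 0`. -/
def operSemialg {g ℓ : ℕ} (p : MatPoly g ℓ ℓ) (H : Type*) [NormedAddCommGroup H]
    [InnerProductSpace ℂ H] [CompleteSpace H] : Set (Fin g → H →L[ℂ] H) :=
  {Z | (∀ j, IsSelfAdjoint (Z j)) ∧ (evalOp p Z).IsPositive}

/-- The operator convex hull of `D_p`, relative to the ambient Hilbert space `𝓚`: the tuples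
`X ∈ 𝕊_n^g` of the form `X = V* Z V`, where `Z ∈ D_p^∞(K)` for a closed subspace `K` of `𝓚`
(a subspace of a Hilbert space is closed iff it is complete) and `V : ℂ^n → K` is an isometry. -/
def operHull (𝓚 : Type*) [NormedAddCommGroup 𝓚] [InnerProductSpace ℂ 𝓚] {g ℓ : ℕ}
    (p : MatPoly g ℓ ℓ) (n : ℕ) : Set (Tuple g n) :=
  {X | X ∈ hermTuples g n ∧
    ∃ (K : Submodule ℂ 𝓚) (_ : CompleteSpace K) (Z : Fin g → K →L[ℂ] K)
      (V : EuclideanSpace ℂ (Fin n) →ₗᵢ[ℂ] K),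
      Z ∈ operSemialg p K ∧
      ∀ j, Matrix.toEuclideanCLM (n := Fin n) (𝕜 := ℂ) (X j) =
        V.toContinuousLinearMap.adjoint ∘L Z j ∘L V.toContinuousLinearMap}

/-! ### Moment sequences, Hankel and localizing matrices, the lift -/

/-- The free Hankel matrix `H(Y) = (Y_{α*β})_{α,β}`, a block matrix indexed by words. (In Mathlib,
`Matrix.PosSemidef` over an infinite index type tests the quadratic form on finitely supported
vectors.) -/
def hankel {g n : ℕ} (Y : Word g → Matrix (Fin n) (Fin n) ℂ) :
    Matrix (Word g × Fin n) (Word g × Fin n) ℂ :=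
  Matrix.of fun a b => Y (star a.1 * b.1) a.2 b.2

/-- The localizing matrix `H_p(Y)`, with blocks `∑_γ p_γ ⊗ Y_{α*γβ}` acting on `ℂ^ℓ ⊗ ℂ^n`. Here
`(p i k).coeff γ` is the `(i, k)` entry of the matrix coefficient `p_γ`. -/
def localizing {g ℓ n : ℕ} (p : MatPoly g ℓ ℓ) (Y : Word g → Matrix (Fin n) (Fin n) ℂ) :
    Matrix (Word g × Fin ℓ × Fin n) (Word g × Fin ℓ × Fin n) ℂ :=
  Matrix.of fun a b =>
    (p a.2.1 b.2.1).coeff.sum fun γ c => c * Y (star a.1 * γ * b.1) a.2.2 b.2.2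

/-- `L_p(n)`: the moment sequences `Y` of `n × n` matrices with `H(Y) ⪰ 0` and `H_p(Y) ⪰ 0`. -/
def lift {g ℓ : ℕ} (p : MatPoly g ℓ ℓ) (n : ℕ) : Set (Word g → Matrix (Fin n) (Fin n) ℂ) :=
  {Y | Y 1 = 1 ∧ (∀ α, Y (star α) = (Y α)ᴴ) ∧ (hankel Y).PosSemidef ∧ (localizing p Y).PosSemidef}

/-- The projection `Y ↦ Ŷ = (Y_{x_1}, …, Y_{x_g})`. -/
def firstMoments {g n : ℕ} (Y : Word g → Matrix (Fin n) (Fin n) ℂ) : Tuple g n :=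
  fun j => Y (FreeMonoid.of j)

/-- The projected lift `{Ŷ : Y ∈ L_p(n)}`. -/
def liftHat {g ℓ : ℕ} (p : MatPoly g ℓ ℓ) (n : ℕ) : Set (Tuple g n) := firstMoments '' lift p n

end FreeLasserre

end

open scoped ComplexOrder Matrix InnerProductSpace

noncomputable section

namespace FreeLasserre

/-! ### Positive semidefinite kernels as Gram matrices -/

/-! The equality of the two sets is a GNS construction. If X = V*ZV, the moments V*Z^αV lie in the
lift: their Hankel matrix is a Gram matrix, and their localizing matrix is a matrix of the positive
operator p(Z) (`opMoments_mem_lift`). Conversely, H(Y) ⪰ 0 makes ℂ⟨x⟩ ⊗ ℂ^n a pre-Hilbert space on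
which left multiplication by x_j is symmetric, and H_p(Y) ⪰ 0 says that p is positive at these
multiplications. Evaluating the archimedean identity at them gives ∑ ‖x_j v‖² ≤ K²‖v‖²
(`IsArchimedean.exists_bound`), so they extend to bounded self-adjoint operators on the completion
(`exists_operSemialg`). Compressing to the vectors carried by the empty word returns the first
moments. There are countably many words, so the completion is separable and embeds in 𝓚.

The remaining claims are read off the lift. The same bound gives entries of Y_α of modulus at most
K^|α|, so the lift is compact by Tychonoff (`IsArchimedean.isCompact_lift`), and so is its
projection. The projection is matrix convex (`isMatrixConvex_liftHat`) and contains D_p, because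
matrices are operators; hence it contains the matrix convex hull. -/

/-- The sesquilinear form on finitely supported vectors given by an infinite matrix. -/
def matForm {ι : Type*} (M : Matrix ι ι ℂ) (v w : ι →₀ ℂ) : ℂ :=
  v.sum fun i a => w.sum fun j b => star a * M i j * b

lemma matForm_single {ι : Type*} (M : Matrix ι ι ℂ) (i j : ι) :
    matForm M (Finsupp.single i 1) (Finsupp.single j 1) = M i j := by
  simp [matForm]

/-- The positive semidefinite form of a positive semidefinite infinite matrix. -/
abbrev gramCore {ι : Type*} {M : Matrix ι ι ℂ} (hM : M.PosSemidef) :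
    PreInnerProductSpace.Core ℂ (ι →₀ ℂ) where
  inner := matForm M
  conj_inner_symm v w := by
    simp only [matForm]
    rw [Finsupp.sum_comm]
    simp only [map_finsuppSum]
    refine Finsupp.sum_congr fun i _ => Finsupp.sum_congr fun j _ => ?_
    rw [← hM.1.apply i j]
    simp only [RCLike.star_def, map_mul, RCLike.conj_conj]
    ring
  re_inner_nonneg v := (Complex.le_def.1 (hM.2 v)).1
  add_left u v w := by
    simp only [matForm]
    rw [Finsupp.sum_add_index'] <;> simp [← Finsupp.sum_add, add_mul]
  smul_left v w r := by
    simp only [matForm]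
    rw [Finsupp.sum_smul_index] <;> simp [Finsupp.mul_sum, ← mul_assoc]

/-- A positive semidefinite infinite matrix is the Gram matrix of a family of vectors in a Hilbert
space with dense span. -/
theorem exists_gram {ι : Type} {M : Matrix ι ι ℂ} (hM : M.PosSemidef) :
    ∃ (H : Type) (_ : NormedAddCommGroup H) (_ : InnerProductSpace ℂ H) (_ : CompleteSpace H)
      (T : (ι →₀ ℂ) →ₗ[ℂ] H), DenseRange T ∧ ∀ v w, ⟪T v, T w⟫_ℂ = matForm M v w := by
  let c : PreInnerProductSpace.Core ℂ (ι →₀ ℂ) := gramCore hM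
  let : SeminormedAddCommGroup (ι →₀ ℂ) :=
    InnerProductSpace.Core.toSeminormedAddCommGroup (𝕜 := ℂ)
  let : InnerProductSpace ℂ (ι →₀ ℂ) := .ofCore _
  -- The form may be degenerate; the Hausdorff completion also collapses its null vectors, so `T`
  -- need not be injective.
  refine ⟨UniformSpace.Completion (ι →₀ ℂ), inferInstance, inferInstance, inferInstance,
    (UniformSpace.Completion.toComplL (𝕜 := ℂ) (E := ι →₀ ℂ)).toLinearMap, ?_, ?_⟩
  · exact UniformSpace.Completion.denseRange_coe
  · intro v w
    exact UniformSpace.Completion.inner_coe v w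

/-- Orthonormal families in a separable space are countable. -/
theorem countable_of_orthonormal {H ι : Type*} [NormedAddCommGroup H] [InnerProductSpace ℂ H]
    [TopologicalSpace.SeparableSpace H] {e : ι → H} (he : Orthonormal ℂ e) : Countable ι := by
  have hd : Pairwise (Function.onFun Disjoint fun i => Metric.ball (e i) (1 / 2)) := by
    intro i j hij
    refine Metric.ball_disjoint_ball ?_
    have h1 : ‖e i - e j‖ ^ 2 = 2 := by
      rw [@norm_sub_sq ℂ, he.1 i, he.1 j, he.2 hij]; norm_num
    rw [dist_eq_norm]
    nlinarith [norm_nonneg (e i - e j)]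
  have := Set.PairwiseDisjoint.countable_of_isOpen (a := Set.univ)
    (s := fun i => Metric.ball (e i) (1 / 2))
    (fun i _ j _ hij => hd hij) (fun i _ => Metric.isOpen_ball)
    (fun i _ => Metric.nonempty_ball.2 (by norm_num))
  exact Set.countable_univ_iff.1 this

/-- A separable Hilbert space embeds isometrically in any infinite-dimensional Hilbert space. -/
theorem exists_linearIsometry_of_separable {H 𝓚 : Type*} [NormedAddCommGroup H]
    [InnerProductSpace ℂ H] [CompleteSpace H] [TopologicalSpace.SeparableSpace H]
    [NormedAddCommGroup 𝓚] [InnerProductSpace ℂ 𝓚] [CompleteSpace 𝓚]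
    (hinf : ¬ FiniteDimensional ℂ 𝓚) : Nonempty (H →ₗᵢ[ℂ] 𝓚) := by
  obtain ⟨w, b, -⟩ := exists_hilbertBasis ℂ H
  obtain ⟨w', b', -⟩ := exists_hilbertBasis ℂ 𝓚
  have hw : Countable w := countable_of_orthonormal b.orthonormal
  have hw' : Infinite w' := by
    by_contra h
    have := not_infinite_iff_finite.1 h
    have := Fintype.ofFinite w'
    exact hinf (b'.toOrthonormalBasis.toBasis.finiteDimensional_of_finite)
  obtain ⟨f, hf⟩ := hw.exists_injective_nat
  have ho : Orthonormal ℂ fun i => b' (Infinite.natEmbedding w' (f i)) :=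
    b'.orthonormal.comp _ ((Infinite.natEmbedding w').injective.comp hf)
  exact ⟨ho.orthogonalFamily.linearIsometry.comp b.repr.toLinearIsometry⟩

/-- A positive semidefinite matrix with countable index set is the Gram matrix of a family of
vectors with dense span in a closed subspace of a given infinite-dimensional Hilbert space. -/
theorem exists_gram_subspace {𝓚 : Type*} [NormedAddCommGroup 𝓚] [InnerProductSpace ℂ 𝓚]
    [CompleteSpace 𝓚] (hinf : ¬ FiniteDimensional ℂ 𝓚) {ι : Type} [Countable ι] {M : Matrix ι ι ℂ}
    (hM : M.PosSemidef) :
    ∃ (K : Submodule ℂ 𝓚) (_ : CompleteSpace K) (T : (ι →₀ ℂ) →ₗ[ℂ] K), DenseRange T ∧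
      ∀ v w, ⟪T v, T w⟫_ℂ = matForm M v w := by
  obtain ⟨H, _, _, _, T, hT, hTM⟩ := exists_gram hM
  have : TopologicalSpace.SeparableSpace H := by
    rw [← TopologicalSpace.isSeparable_univ_iff, ← hT.closure_range]
    refine TopologicalSpace.IsSeparable.closure ?_
    -- The dense range is the span of countably many vectors, hence separable.
    have : Set.range T = (Submodule.span ℂ (Set.range fun i => T (Finsupp.single i 1)) : Set H) := by
      rw [← LinearMap.coe_range, LinearMap.range_eq_map, ← (Finsupp.basisSingleOne).span_eq,
        Submodule.map_span, ← Set.range_comp]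
      simp [Function.comp_def]
    rw [this]
    exact (Set.countable_range _).isSeparable.span
  obtain ⟨J⟩ := exists_linearIsometry_of_separable (H := H) hinf
  let K : Submodule ℂ 𝓚 := LinearMap.range J.toLinearMap
  let e : H ≃ₗᵢ[ℂ] K := J.equivRange
  have : CompleteSpace K := J.isometry.isUniformInducing.isComplete_range.completeSpace_coe
  refine ⟨K, this, e.toLinearEquiv.toLinearMap ∘ₗ T, ?_, ?_⟩
  · exact e.surjective.denseRange.comp hT e.continuous
  · intro v w
    simp [hTM]

/-- The matrix of a positive operator with respect to a family of vectors is positive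
semidefinite. -/
theorem posSemidef_of_isPositive {H ι : Type*} [NormedAddCommGroup H] [InnerProductSpace ℂ H]
    {A : H →L[ℂ] H} (hA : A.IsPositive) (u : ι → H) :
    (Matrix.of fun i j => ⟪u i, A (u j)⟫_ℂ).PosSemidef := by
  refine ⟨?_, fun x => ?_⟩
  · ext i j
    simp only [Matrix.conjTranspose_apply, Matrix.of_apply]
    rw [← starRingEnd_apply, inner_conj_symm, hA.isSymmetric.apply_clm]
  · have := hA.inner_nonneg_right (x.sum fun i a => a • u i)
    convert this using 1
    simp only [Finsupp.sum, map_sum, sum_inner, inner_sum, map_smul, inner_smul_left,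
      inner_smul_right, Matrix.of_apply, Complex.star_def]
    simp only [Finset.mul_sum]
    rw [Finset.sum_comm]
    refine Finset.sum_congr rfl fun i _ => Finset.sum_congr rfl fun j _ => by ring

/-- Gram matrices are positive semidefinite. -/
theorem posSemidef_inner {H ι : Type*} [NormedAddCommGroup H] [InnerProductSpace ℂ H] (u : ι → H) :
    (Matrix.of fun i j => ⟪u i, u j⟫_ℂ).PosSemidef :=
  posSemidef_of_isPositive (A := ContinuousLinearMap.id ℂ H) ContinuousLinearMap.isPositive_one u

/-! ### Moment sequences of operator tuples -/

lemma evalHom_apply {g : ℕ} {A : Type*} [Ring A] [Algebra ℂ A] (X : Fin g → A) (f : FreePoly g) :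
    evalHom X f = f.coeff.sum fun w c => c • FreeMonoid.lift X w :=
  MonoidAlgebra.lift_apply _ _

lemma star_lift_word {g : ℕ} {A : Type*} [Monoid A] [StarMul A] {X : Fin g → A}
    (hX : ∀ j, IsSelfAdjoint (X j)) (α : Word g) :
    star (FreeMonoid.lift X α) = FreeMonoid.lift X (star α) := by
  induction α using FreeMonoid.inductionOn with
  | one => simp
  | of j => simpa using (hX j).star_eq
  | mul α β hα hβ => simp [hα, hβ]

lemma evalOp_apply {g ℓ : ℕ} {H : Type*} [NormedAddCommGroup H] [InnerProductSpace ℂ H]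
    (p : MatPoly g ℓ ℓ) (Z : Fin g → H →L[ℂ] H) (v : PiLp 2 (fun _ : Fin ℓ => H)) (i : Fin ℓ) :
    evalOp p Z v i = ∑ k, evalHom Z (p i k) (v k) := by
  simp [evalOp, opOfMatrix]

lemma inner_toEuclideanCLM_eq_sum {n : ℕ} (A : Matrix (Fin n) (Fin n) ℂ)
    (x y : EuclideanSpace ℂ (Fin n)) :
    ⟪x, Matrix.toEuclideanCLM (n := Fin n) (𝕜 := ℂ) A y⟫_ℂ =
      ∑ i, ∑ k, star (x i) * (A i k * y k) := by
  rw [PiLp.inner_apply]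
  refine Finset.sum_congr rfl fun i _ => ?_
  rw [Matrix.ofLp_toEuclideanCLM, RCLike.inner_apply, mul_comm, Matrix.mulVec, dotProduct,
    Finset.mul_sum]
  rfl

lemma inner_single_toEuclideanCLM {n : ℕ} (A : Matrix (Fin n) (Fin n) ℂ) (i k : Fin n) :
    ⟪EuclideanSpace.single i (1 : ℂ), Matrix.toEuclideanCLM (n := Fin n) (𝕜 := ℂ) A
      (EuclideanSpace.single k 1)⟫_ℂ = A i k := by
  rw [EuclideanSpace.inner_single_left]
  simp

lemma toEuclideanCLM_eq_iff {n : ℕ} {A : Matrix (Fin n) (Fin n) ℂ}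
    {B : EuclideanSpace ℂ (Fin n) →L[ℂ] EuclideanSpace ℂ (Fin n)} :
    Matrix.toEuclideanCLM (n := Fin n) (𝕜 := ℂ) A = B ↔
      ∀ i k, A i k = ⟪EuclideanSpace.single i (1 : ℂ), B (EuclideanSpace.single k 1)⟫_ℂ := by
  refine ⟨fun h i k => by rw [← h, inner_single_toEuclideanCLM], fun h => ?_⟩
  obtain ⟨C, rfl⟩ : ∃ C, Matrix.toEuclideanCLM (n := Fin n) (𝕜 := ℂ) C = B :=
    (Matrix.toEuclideanCLM (n := Fin n) (𝕜 := ℂ)).surjective B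
  congr 1
  refine Matrix.ext fun i k => ?_
  rw [h, inner_single_toEuclideanCLM]

/-- In the order of ℂ, `0 ≤ z` also says that z is real, and over ℂ a real quadratic form forces the
operator to be symmetric. -/
theorem isPositive_of_inner_nonneg {H : Type*} [NormedAddCommGroup H] [InnerProductSpace ℂ H]
    {A : H →L[ℂ] H} (hA : ∀ x, 0 ≤ ⟪x, A x⟫_ℂ) : A.IsPositive := by
  refine (ContinuousLinearMap.isPositive_iff_complex _).2 fun x => ?_
  have h := Complex.le_def.1 (hA x)
  rw [← inner_conj_symm]
  refine ⟨Complex.ext (by simp) (by simpa [-inner_conj_symm] using h.2.symm),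
    by simpa [-inner_conj_symm] using h.1⟩

/-- The moment sequence `α ↦ V* Z^α V` of a tuple of operators, where `V` is given by the images
`u i` of the standard basis vectors. -/
def opMoments {g n : ℕ} {H : Type*} [NormedAddCommGroup H] [InnerProductSpace ℂ H]
    (Z : Fin g → H →L[ℂ] H) (u : Fin n → H) (α : Word g) : Matrix (Fin n) (Fin n) ℂ :=
  Matrix.of fun i k => ⟪u i, FreeMonoid.lift Z α (u k)⟫_ℂ

section

variable {g ℓ n : ℕ} {H : Type*} [NormedAddCommGroup H] [InnerProductSpace ℂ H] [CompleteSpace H]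

lemma inner_lift_word {Z : Fin g → H →L[ℂ] H} (hZ : ∀ j, IsSelfAdjoint (Z j)) (α : Word g)
    (x y : H) : ⟪x, FreeMonoid.lift Z (star α) y⟫_ℂ = ⟪FreeMonoid.lift Z α x, y⟫_ℂ := by
  rw [← star_lift_word hZ, ContinuousLinearMap.star_eq_adjoint,
    ContinuousLinearMap.adjoint_inner_right]

/-- Self-adjointness of Z moves α* across the inner product, so the Hankel entries are inner
products of the vectors Z^α u_i, and the localizing entries are those of p(Z) in the vectors e_i ⊗
Z^α u_k. -/
theorem opMoments_mem_lift {p : MatPoly g ℓ ℓ} {Z : Fin g → H →L[ℂ] H} (hZ : Z ∈ operSemialg p H)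
    {u : Fin n → H} (hu : Orthonormal ℂ u) : opMoments Z u ∈ lift p n := by
  obtain ⟨hs, hp⟩ := hZ
  refine ⟨?_, ?_, ?_, ?_⟩
  · ext i k
    simp [opMoments, orthonormal_iff_ite.1 hu, Matrix.one_apply]
  · intro α
    ext i k
    simp only [opMoments, Matrix.of_apply, Matrix.conjTranspose_apply]
    rw [inner_lift_word hs, ← starRingEnd_apply, inner_conj_symm]
  · convert posSemidef_inner (fun a : Word g × Fin n => FreeMonoid.lift Z a.1 (u a.2)) using 1
    ext a b
    simp only [hankel, opMoments, Matrix.of_apply, map_mul]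
    exact inner_lift_word hs _ _ _
  · convert posSemidef_of_isPositive hp (fun a : Word g × Fin ℓ × Fin n =>
      PiLp.single 2 a.2.1 (FreeMonoid.lift Z a.1 (u a.2.2))) using 1
    ext a b
    simp only [localizing, opMoments, Matrix.of_apply, map_mul]
    rw [PiLp.inner_apply, Finset.sum_eq_single a.2.1 (fun i _ hi => by simp [hi]) (by simp)]
    rw [evalOp_apply, Finset.sum_eq_single b.2.1 (fun i _ hi => by simp [hi]) (by simp)]
    simp only [PiLp.single_eq_same]
    rw [← inner_lift_word hs, evalHom_apply]
    simp only [Finsupp.sum, sum_apply, map_sum, inner_sum, mul_assoc]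
    refine Finset.sum_congr rfl fun γ _ => ?_
    simp [inner_smul_right]

theorem mem_liftHat_of_operSemialg {p : MatPoly g ℓ ℓ} {Z : Fin g → H →L[ℂ] H}
    (hZ : Z ∈ operSemialg p H) (V : EuclideanSpace ℂ (Fin n) →ₗᵢ[ℂ] H) {X : Tuple g n}
    (hX : ∀ j, Matrix.toEuclideanCLM (n := Fin n) (𝕜 := ℂ) (X j) =
        V.toContinuousLinearMap.adjoint ∘L Z j ∘L V.toContinuousLinearMap) :
    X ∈ liftHat p n := by
  have ho : Orthonormal ℂ fun i : Fin n => V (EuclideanSpace.single i 1) := by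
    have := (EuclideanSpace.basisFun (Fin n) ℂ).orthonormal.comp_linearIsometry V
    simpa [Function.comp_def] using this
  refine ⟨_, opMoments_mem_lift hZ ho, ?_⟩
  funext j
  ext i k
  have := toEuclideanCLM_eq_iff.1 (hX j) i k
  rw [this]
  simp [firstMoments, opMoments, ContinuousLinearMap.adjoint_inner_right]

end

theorem semialg_subset_liftHat {g ℓ : ℕ} (p : MatPoly g ℓ ℓ) (n : ℕ) :
    semialg p n ⊆ liftHat p n := by
  rintro X ⟨hX, hp⟩
  let Φ : Matrix (Fin n) (Fin n) ℂ ≃⋆ₐ[ℂ]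
      (EuclideanSpace ℂ (Fin n) →L[ℂ] EuclideanSpace ℂ (Fin n)) :=
    Matrix.toEuclideanCLM (n := Fin n) (𝕜 := ℂ)
  have hev (f : FreePoly g) : evalHom (fun j => Φ (X j)) f = Φ (evalHom X f) := by
    have : evalHom (fun j => Φ (X j)) = (Φ.toAlgEquiv.toAlgHom).comp (evalHom X) := by
      refine AlgHom.ext fun q => ?_
      rw [MonoidAlgebra.lift_unique (evalHom fun j => Φ (X j)) q, MonoidAlgebra.lift_unique
        ((Φ.toAlgEquiv.toAlgHom).comp (evalHom X)) q]
      refine Finsupp.sum_congr fun w _ => ?_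
      simp only [evalHom, MonoidAlgebra.lift_single, AlgHom.comp_apply, one_smul]
      congr 1
      exact DFunLike.congr_fun (FreeMonoid.hom_eq (f := FreeMonoid.lift fun j => Φ (X j))
        (g := (Φ : _ →* _).comp (FreeMonoid.lift X)) fun j => by simp) w
    rw [this]
    rfl
  -- A matrix tuple is its own dilation: H = ℂ^n and V is the identity.
  refine mem_liftHat_of_operSemialg (Z := fun j => Φ (X j)) (V := LinearIsometry.id) ⟨?_, ?_⟩ ?_
  · exact fun j => (hX j).isSelfAdjoint.map Φ
  · refine isPositive_of_inner_nonneg fun v => ?_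
    convert hp.dotProduct_mulVec_nonneg fun a => v a.1 a.2 using 1
    simp only [PiLp.inner_apply (𝕜 := ℂ) v, evalOp_apply, hev, dotProduct, Matrix.mulVec, evalMat,
      Fintype.sum_prod_type, inner_sum, Φ, inner_toEuclideanCLM_eq_sum, Matrix.of_apply,
      Pi.star_apply, Finset.mul_sum]
    refine Finset.sum_congr rfl fun i _ => Finset.sum_comm
  · intro j
    ext1 x
    refine ext_inner_left ℂ fun y => ?_
    rw [ContinuousLinearMap.comp_apply, ContinuousLinearMap.adjoint_inner_right]
    rfl

/-! ### The left regular representation and the archimedean bound -/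

/-- Left multiplication by a word, on finitely supported vectors indexed by `⟨x⟩ × {1, …, n}`. -/
def wordShift {g n : ℕ} (α : Word g) : Module.End ℂ (Word g × Fin n →₀ ℂ) :=
  Finsupp.lmapDomain ℂ ℂ fun a => (α * a.1, a.2)

/-- Left multiplication by the variable `x_j`. -/
def varShift {g n : ℕ} (j : Fin g) : Module.End ℂ (Word g × Fin n →₀ ℂ) :=
  wordShift (FreeMonoid.of j)

lemma wordShift_single {g n : ℕ} (α : Word g) (a : Word g × Fin n) (c : ℂ) :
    wordShift α (Finsupp.single a c) = Finsupp.single (α * a.1, a.2) c := by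
  simp [wordShift]

lemma lift_varShift {g n : ℕ} (α : Word g) :
    FreeMonoid.lift (varShift (n := n)) α = wordShift α := by
  induction α using FreeMonoid.inductionOn with
  | one =>
    refine Finsupp.lhom_ext fun a c => ?_
    simp [wordShift_single]
  | of j => simp [varShift]
  | mul α β hα hβ =>
    refine Finsupp.lhom_ext fun a c => ?_
    simp [hα, hβ, wordShift_single, mul_assoc]

lemma evalHom_varShift_apply {g n : ℕ} (f : FreePoly g) (v : Word g × Fin n →₀ ℂ) :
    evalHom varShift f v = f.coeff.sum fun γ c => c • wordShift γ v := by
  rw [evalHom_apply]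
  simp [Finsupp.sum, lift_varShift]

lemma evalHom_adj {g : ℕ} {A : Type*} [Ring A] [Algebra ℂ A] (X : Fin g → A) (f : FreePoly g) :
    evalHom X (adj f) = f.coeff.sum fun w c => star c • FreeMonoid.lift X (star w) := by
  simp [adj, Finsupp.sum, evalHom]

lemma evalHom_var {g : ℕ} {A : Type*} [Ring A] [Algebra ℂ A] (X : Fin g → A) (j : Fin g) :
    evalHom X (var j) = X j := by
  simp [var, evalHom]

lemma matForm_mapDomain {ι κ κ' : Type*} (M : Matrix ι ι ℂ) (e : κ → ι) (e' : κ' → ι)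
    (v : κ →₀ ℂ) (w : κ' →₀ ℂ) :
    matForm M (v.mapDomain e) (w.mapDomain e') =
      v.sum fun i a => w.sum fun j b => star a * M (e i) (e' j) * b := by
  rw [matForm, Finsupp.sum_mapDomain_index (by simp)
    (fun _ _ _ => by simp [add_mul, Finsupp.sum_add])]
  exact Finsupp.sum_congr fun i _ =>
    Finsupp.sum_mapDomain_index (by simp) (fun _ _ _ => by simp [mul_add])

lemma matForm_mapDomain_right {ι κ : Type*} (M : Matrix ι ι ℂ) (e : κ → ι)
    (v : ι →₀ ℂ) (w : κ →₀ ℂ) :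
    matForm M v (w.mapDomain e) =
      v.sum fun i a => w.sum fun j b => star a * M i (e j) * b := by
  simpa using matForm_mapDomain M id e v w

/-- This is the Hankel property: (αβ)*δ = β*(α*δ), so left multiplication by α* is a formal adjoint
of left multiplication by α. -/
lemma matForm_wordShift {g n : ℕ} (Y : Word g → Matrix (Fin n) (Fin n) ℂ) (α : Word g)
    (v w : Word g × Fin n →₀ ℂ) :
    matForm (hankel Y) (wordShift α v) w = matForm (hankel Y) v (wordShift (star α) w) := by
  have := matForm_mapDomain (hankel Y) (fun a => (α * a.1, a.2)) id v w
  rw [Finsupp.mapDomain_id] at this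
  simp only [wordShift, Finsupp.lmapDomain_apply, this, matForm_mapDomain_right]
  simp [hankel, mul_assoc]

/-- Identifies the localizing form with the Hankel form in which p acts by left multiplication on
the second argument. -/
lemma matForm_localizing_mapDomain {g ℓ n : ℕ} (p : MatPoly g ℓ ℓ)
    (Y : Word g → Matrix (Fin n) (Fin n) ℂ) (i k : Fin ℓ) (v w : Word g × Fin n →₀ ℂ) :
    matForm (localizing p Y) (v.mapDomain fun a => (a.1, i, a.2))
        (w.mapDomain fun a => (a.1, k, a.2)) =
      (p i k).coeff.sum fun γ c => c * matForm (hankel Y) v (wordShift γ w) := by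
  rw [matForm_mapDomain]
  simp only [matForm_mapDomain_right, wordShift, Finsupp.lmapDomain_apply,
    localizing, hankel, Matrix.of_apply, Finsupp.sum, Finset.mul_sum, Finset.sum_mul]
  conv_rhs => rw [Finset.sum_comm]; enter [2, a]; rw [Finset.sum_comm]
  refine Finset.sum_congr rfl fun a _ => Finset.sum_congr rfl fun b _ =>
    Finset.sum_congr rfl fun γ _ => ?_
  rw [← mul_assoc (star a.1)]
  ring

section

variable {g ℓ n : ℕ} {H : Type*} [NormedAddCommGroup H] [InnerProductSpace ℂ H]
  {Y : Word g → Matrix (Fin n) (Fin n) ℂ} {T : (Word g × Fin n →₀ ℂ) →ₗ[ℂ] H}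

lemma inner_wordShift (hT : ∀ v w, ⟪T v, T w⟫_ℂ = matForm (hankel Y) v w) (α : Word g)
    (v w : Word g × Fin n →₀ ℂ) :
    ⟪T (wordShift α v), T w⟫_ℂ = ⟪T v, T (wordShift (star α) w)⟫_ℂ := by
  rw [hT, hT, matForm_wordShift]

lemma inner_evalHom_adj (hT : ∀ v w, ⟪T v, T w⟫_ℂ = matForm (hankel Y) v w) (f : FreePoly g)
    (v w : Word g × Fin n →₀ ℂ) :
    ⟪T v, T (evalHom varShift (adj f) w)⟫_ℂ = ⟪T (evalHom varShift f v), T w⟫_ℂ := by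
  rw [evalHom_adj, evalHom_varShift_apply]
  simp [Finsupp.sum, lift_varShift, inner_wordShift hT, mul_comm]

lemma inner_evalHom_nonneg {p : MatPoly g ℓ ℓ} (hT : ∀ v w, ⟪T v, T w⟫_ℂ = matForm (hankel Y) v w)
    (hp : (localizing p Y).PosSemidef) (v : Fin ℓ → (Word g × Fin n →₀ ℂ)) :
    0 ≤ ∑ i, ∑ k, ⟪T (v i), T (evalHom varShift (p i k) (v k))⟫_ℂ := by
  have h := hp.2 (∑ i, (v i).mapDomain fun a => (a.1, i, a.2))
  change 0 ≤ matForm _ _ _ at h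
  -- This second Gram representation serves only to expand the localizing form over the sum by
  -- sesquilinearity.
  obtain ⟨H', _, _, _, T', -, hT'⟩ := exists_gram hp
  rw [← hT', map_sum, sum_inner] at h
  simp only [inner_sum, hT', matForm_localizing_mapDomain] at h
  convert h using 5 with i _ k _
  rw [evalHom_varShift_apply]
  simp [Finsupp.sum, hT]

end

/-- For an archimedean polynomial, the variables act on the Hankel form of a moment sequence in the
lift as a row contraction, up to a constant depending only on the polynomial. -/
theorem IsArchimedean.exists_bound {g ℓ : ℕ} {p : MatPoly g ℓ ℓ} (hp : IsArchimedean p) :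
    ∃ K : ℝ, 0 < K ∧ ∀ (n : ℕ), ∀ Y ∈ lift p n, ∀ v : Word g × Fin n →₀ ℂ,
      ∑ j, matForm (hankel Y) (varShift j v) (varShift j v) ≤ (K : ℂ) ^ 2 * matForm (hankel Y) v v := by
  obtain ⟨K, hK, r, q, t, s, f, h⟩ := hp
  refine ⟨K, hK, fun n Y hY v => ?_⟩
  obtain ⟨-, -, hH, hL⟩ := hY
  obtain ⟨H, _, _, _, T, -, hT⟩ := exists_gram hH
  -- The archimedean identity, evaluated in the left regular representation and paired with v.
  have h0 := congrArg (fun f => ⟪T v, T (evalHom varShift f v)⟫_ℂ) (congrFun (congrFun h 0) 0)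
  have hnonneg : 0 ≤ ⟪T v, T (evalHom varShift
      ((∑ i, matAdj (s i) * s i + ∑ i, matAdj (f i) * p * f i) 0 0) v)⟫_ℂ := by
    simp only [Matrix.add_apply, Matrix.sum_apply, map_add, map_sum, LinearMap.add_apply,
      inner_add_right, LinearMap.sum_apply, inner_sum]
    refine add_nonneg (Finset.sum_nonneg fun i _ => ?_) (Finset.sum_nonneg fun i _ => ?_)
    · simp only [Matrix.mul_apply, matAdj, Matrix.transpose_apply, Matrix.map_apply, map_sum,
        LinearMap.sum_apply, inner_sum, map_mul, Module.End.mul_apply, inner_evalHom_adj hT]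
      exact Finset.sum_nonneg fun a _ => hT _ _ ▸ hH.2 _
    · convert inner_evalHom_nonneg hT hL fun a => evalHom varShift (f i a 0) v
      rw [Finset.sum_comm]
      simp only [Matrix.mul_apply, matAdj, Matrix.transpose_apply, Matrix.map_apply, map_sum,
        LinearMap.sum_apply, inner_sum, map_mul, Module.End.mul_apply, inner_evalHom_adj hT,
        Finset.sum_mul]
  rw [← h0] at hnonneg
  simp only [Matrix.of_apply, map_sub, map_sum, AlgHom.commutes,
    LinearMap.sub_apply, LinearMap.sum_apply, inner_sub_right, inner_sum, sub_nonneg,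
    pow_two] at hnonneg
  convert hnonneg using 1
  · refine Finset.sum_congr rfl fun j _ => ?_
    rw [← hT, varShift, inner_wordShift hT, FreeMonoid.star_of, map_mul, evalHom_var]
    rfl
  · rw [← hT, Module.algebraMap_end_apply, map_smul, inner_smul_right, pow_two]

/-! ### Operators from moment sequences -/

section

variable {g ℓ n : ℕ} {H : Type*} [NormedAddCommGroup H] [InnerProductSpace ℂ H]
  {Y : Word g → Matrix (Fin n) (Fin n) ℂ} {T : (Word g × Fin n →₀ ℂ) →ₗ[ℂ] H}

lemma norm_varShift_le (hT : ∀ v w, ⟪T v, T w⟫_ℂ = matForm (hankel Y) v w) {K : ℝ} (hK : 0 < K)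
    (hb : ∀ v : Word g × Fin n →₀ ℂ, ∑ j, matForm (hankel Y) (varShift j v) (varShift j v) ≤
      (K : ℂ) ^ 2 * matForm (hankel Y) v v) (j : Fin g) (v : Word g × Fin n →₀ ℂ) :
    ‖T (varShift j v)‖ ≤ K * ‖T v‖ := by
  have h := hb v
  simp only [← hT, inner_self_eq_norm_sq_to_K, Complex.coe_algebraMap] at h
  have h' : ∑ j, ‖T (varShift j v)‖ ^ 2 ≤ K ^ 2 * ‖T v‖ ^ 2 := by exact_mod_cast h
  refine le_of_sq_le_sq ?_ (by positivity)
  rw [mul_pow]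
  exact (Finset.single_le_sum (f := fun j => ‖T (varShift j v)‖ ^ 2) (fun _ _ => by positivity)
    (Finset.mem_univ j)).trans h'

/-- If the variables act boundedly on the Hankel form of a moment sequence in the lift, then they
act as a tuple of bounded operators at which the polynomial is positive. -/
theorem exists_operSemialg [CompleteSpace H] {p : MatPoly g ℓ ℓ}
    (hT : ∀ v w, ⟪T v, T w⟫_ℂ = matForm (hankel Y) v w) (hdense : DenseRange T)
    (hp : (localizing p Y).PosSemidef) {K : ℝ}
    (hK : ∀ j v, ‖T (varShift j v)‖ ≤ K * ‖T v‖) :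
    ∃ Z ∈ operSemialg p H, ∀ j v, Z j (T v) = T (varShift j v) := by
  -- The bound `hK` makes T v ↦ T (x_j v) well defined despite the kernel of T, as well as
  -- continuous.
  let Z : Fin g → H →L[ℂ] H := fun j => (T ∘ₗ varShift j).extendOfNorm T
  have hZ (j v) : Z j (T v) = T (varShift j v) :=
    LinearMap.extendOfNorm_eq hdense ⟨K, hK j⟩ v
  have hlift (α : Word g) : ∀ v, FreeMonoid.lift Z α (T v) = T (wordShift α v) := by
    rw [← lift_varShift]
    induction α using FreeMonoid.inductionOn with
    | one => simp
    | of j => simpa using hZ j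
    | mul α β hα hβ => simp [hα, hβ]
  have heval (f : FreePoly g) (v) : evalHom Z f (T v) = T (evalHom varShift f v) := by
    rw [evalHom_apply, evalHom_varShift_apply]
    simp [Finsupp.sum, hlift]
  refine ⟨Z, ⟨fun j => ?_, isPositive_of_inner_nonneg fun v => ?_⟩, hZ⟩
  · rw [ContinuousLinearMap.isSelfAdjoint_iff_isSymmetric]
    intro x y
    refine hdense.induction_on₂ (p := fun x y => ⟪Z j x, y⟫_ℂ = ⟪x, Z j y⟫_ℂ) ?_ ?_ x y
    · exact isClosed_eq (by fun_prop) (by fun_prop)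
    · intro v w
      rw [hZ, hZ, varShift, inner_wordShift hT, FreeMonoid.star_of]
  · have hd : DenseRange fun v : Fin ℓ → (Word g × Fin n →₀ ℂ) =>
        (WithLp.toLp 2 fun i => T (v i) : PiLp 2 fun _ : Fin ℓ => H) :=
      (PiLp.continuousLinearEquiv 2 ℂ fun _ : Fin ℓ => H).symm.surjective.denseRange.comp
        (DenseRange.piMap fun _ => hdense) (ContinuousLinearEquiv.continuous _)
    refine hd.induction_on (p := fun v => 0 ≤ ⟪v, evalOp p Z v⟫_ℂ) v ?_ fun v => ?_
    · exact isClosed_le (by fun_prop) (by fun_prop)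
    · simp only [PiLp.inner_apply, evalOp_apply, heval, inner_sum]
      exact inner_evalHom_nonneg hT hp v

lemma orthonormal_of_hankel (hT : ∀ v w, ⟪T v, T w⟫_ℂ = matForm (hankel Y) v w) (hY : Y 1 = 1) :
    Orthonormal ℂ fun i : Fin n => T (Finsupp.single (1, i) 1) := by
  rw [orthonormal_iff_ite]
  intro i k
  rw [hT, matForm_single]
  simp [hankel, hY, Matrix.one_apply]

/-- Each letter of α costs a factor K, and Y_α is the compression of left multiplication by α to the
unit vectors of the empty word. -/
lemma norm_moment_le (hT : ∀ v w, ⟪T v, T w⟫_ℂ = matForm (hankel Y) v w) (hY : Y 1 = 1) {K : ℝ}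
    (hK0 : 0 < K) (hK : ∀ j v, ‖T (varShift j v)‖ ≤ K * ‖T v‖) (α : Word g) (i k : Fin n) :
    ‖Y α i k‖ ≤ K ^ α.length := by
  have ho := orthonormal_of_hankel hT hY
  have h1 : ∀ v, ‖T (wordShift α v)‖ ≤ K ^ α.length * ‖T v‖ := by
    rw [← lift_varShift]
    induction α using FreeMonoid.inductionOn with
    | one => simp
    | of j => simpa using hK j
    | mul α β hα hβ =>
      intro v
      rw [map_mul, Module.End.mul_apply, FreeMonoid.length_mul, pow_add, mul_assoc]
      exact (hα _).trans (mul_le_mul_of_nonneg_left (hβ v) (by positivity))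
  have h2 : Y α i k = ⟪T (Finsupp.single (1, i) 1), T (wordShift α (Finsupp.single (1, k) 1))⟫_ℂ := by
    rw [hT, wordShift_single, matForm_single]
    simp [hankel]
  rw [h2]
  refine (norm_inner_le_norm _ _).trans ?_
  rw [ho.1 i, one_mul]
  simpa [ho.1 k] using h1 (Finsupp.single (1, k) 1)

end

lemma exists_linearIsometry_of_orthonormal {n : ℕ} {H : Type*} [NormedAddCommGroup H]
    [InnerProductSpace ℂ H] {u : Fin n → H} (hu : Orthonormal ℂ u) :
    ∃ V : EuclideanSpace ℂ (Fin n) →ₗᵢ[ℂ] H, ∀ i, V (EuclideanSpace.single i 1) = u i := by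
  let b := (EuclideanSpace.basisFun (Fin n) ℂ).toBasis
  have hb (i : Fin n) : b.constr ℂ u (b i) = u i := b.constr_basis ℂ u i
  have hbo : Orthonormal ℂ b := by simp [b]
  refine ⟨(b.constr ℂ u).isometryOfOrthonormal hbo
    (by simpa [Function.comp_def, hb] using hu), fun i => ?_⟩
  have hi : b i = EuclideanSpace.single i 1 := by simp [b]
  rw [← hi]
  exact hb i

theorem liftHat_subset_operHull {𝓚 : Type*} [NormedAddCommGroup 𝓚] [InnerProductSpace ℂ 𝓚]
    [CompleteSpace 𝓚] (hinf : ¬ FiniteDimensional ℂ 𝓚) {g ℓ : ℕ} {p : MatPoly g ℓ ℓ}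
    (hp : IsArchimedean p) (n : ℕ) : liftHat p n ⊆ operHull 𝓚 p n := by
  rintro _ ⟨Y, hY, rfl⟩
  obtain ⟨K, hK, hb⟩ := hp.exists_bound
  obtain ⟨h1, hstar, hH, hL⟩ := id hY
  have : Countable (Word g) := inferInstanceAs (Countable (List (Fin g)))
  obtain ⟨S, _, T, hdense, hT⟩ := exists_gram_subspace hinf hH
  obtain ⟨Z, hZ, hZT⟩ := exists_operSemialg hT hdense hL (norm_varShift_le hT hK (hb n Y hY))
  obtain ⟨V, hV⟩ := exists_linearIsometry_of_orthonormal (orthonormal_of_hankel hT h1)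
  refine ⟨fun j => ?_, S, inferInstance, Z, V, hZ, fun j => ?_⟩
  · rw [Matrix.IsHermitian, firstMoments, ← hstar, FreeMonoid.star_of]
  · rw [toEuclideanCLM_eq_iff]
    intro i k
    simp only [ContinuousLinearMap.comp_apply, ContinuousLinearMap.adjoint_inner_right,
      LinearIsometry.coe_toContinuousLinearMap, hV]
    -- The entry is the Hankel entry at the words ∅ and x_j.
    rw [hZT, hT, varShift, wordShift_single, matForm_single]
    simp [hankel, firstMoments]

theorem operHull_eq_liftHat {𝓚 : Type*} [NormedAddCommGroup 𝓚] [InnerProductSpace ℂ 𝓚]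
    [CompleteSpace 𝓚] (hinf : ¬ FiniteDimensional ℂ 𝓚) {g ℓ : ℕ} {p : MatPoly g ℓ ℓ}
    (hp : IsArchimedean p) (n : ℕ) : operHull 𝓚 p n = liftHat p n := by
  refine Set.Subset.antisymm ?_ (liftHat_subset_operHull hinf hp n)
  rintro X ⟨-, S, _, Z, V, hZ, hX⟩
  exact mem_liftHat_of_operSemialg hZ V hX

/-! ### Compactness of the lift -/

/-- Each finitely supported test vector sees only finitely many entries, so entrywise continuity
suffices. -/
lemma isClosed_posSemidef {ι E : Type*} [TopologicalSpace E] {M : E → Matrix ι ι ℂ}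
    (hM : ∀ i j, Continuous fun x => M x i j) : IsClosed {x | (M x).PosSemidef} := by
  simp only [Matrix.PosSemidef, Matrix.IsHermitian, ← Matrix.ext_iff, Set.ofPred_and,
    Set.ofPred_forall, Finsupp.sum, Matrix.conjTranspose_apply]
  refine IsClosed.inter ?_ ?_
  · exact isClosed_iInter fun i => isClosed_iInter fun j =>
      isClosed_eq (hM j i).star (hM i j)
  · refine isClosed_iInter fun v => isClosed_le continuous_const ?_
    exact continuous_finsetSum _ fun i _ => continuous_finsetSum _ fun j _ =>
      (continuous_const.mul (hM i j)).mul continuous_const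

theorem IsArchimedean.isCompact_lift {g ℓ : ℕ} {p : MatPoly g ℓ ℓ} (hp : IsArchimedean p) (n : ℕ) :
    IsCompact (lift p n) := by
  obtain ⟨K, hK, hb⟩ := hp.exists_bound
  -- Tychonoff: the radius may grow with α, since the topology is that of entrywise convergence.
  have hcomp : IsCompact (Set.univ.pi fun α : Word g => Set.univ.pi fun i : Fin n =>
      Set.univ.pi fun k : Fin n => Metric.closedBall (0 : ℂ) (K ^ α.length)) :=
    isCompact_univ_pi fun α => isCompact_univ_pi fun i => isCompact_univ_pi fun k =>
      isCompact_closedBall _ _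
  refine hcomp.of_isClosed_subset ?_ ?_
  · have hc (α : Word g) (i k : Fin n) :
        Continuous fun Y : Word g → Matrix (Fin n) (Fin n) ℂ => Y α i k := by fun_prop
    refine IsClosed.inter (isClosed_eq (by fun_prop) continuous_const) (IsClosed.inter ?_
      (IsClosed.inter (isClosed_posSemidef fun a b => hc _ _ _)
        (isClosed_posSemidef fun a b => ?_)))
    · change IsClosed {Y : Word g → Matrix (Fin n) (Fin n) ℂ | ∀ α, Y (star α) = (Y α)ᴴ}
      rw [Set.ofPred_forall]
      exact isClosed_iInter fun α => isClosed_eq (by fun_prop) (by fun_prop)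
    · exact continuous_finsetSum _ fun γ _ => continuous_const.mul (hc _ _ _)
  · intro Y hY α _ i _ k _
    obtain ⟨H, _, _, _, T, -, hT⟩ := exists_gram hY.2.2.1
    rw [mem_closedBall_zero_iff]
    exact norm_moment_le hT hY.1 hK (norm_varShift_le hT hK (hb n Y hY)) α i k

theorem IsArchimedean.isCompact_liftHat {g ℓ : ℕ} {p : MatPoly g ℓ ℓ} (hp : IsArchimedean p)
    (n : ℕ) : IsCompact (liftHat p n) :=
  (hp.isCompact_lift n).image (continuous_pi fun j => continuous_apply (FreeMonoid.of j))

lemma continuous_tupleNorm {g n : ℕ} : Continuous (tupleNorm (g := g) (n := n)) := by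
  have : Continuous fun A : Matrix (Fin n) (Fin n) ℂ =>
      Matrix.toEuclideanCLM (n := Fin n) (𝕜 := ℂ) A :=
    LinearMap.continuous_of_finiteDimensional
      (Matrix.toEuclideanCLM (n := Fin n) (𝕜 := ℂ)).toAlgEquiv.toLinearMap
  unfold tupleNorm
  fun_prop

theorem isBoundedSet_of_isCompact {g n : ℕ} {S : Set (Tuple g n)} (hS : IsCompact S) :
    IsBoundedSet S := by
  obtain ⟨C, hC⟩ := hS.bddAbove_image continuous_tupleNorm.continuousOn
  exact ⟨C, fun X hX => hC ⟨X, hX, rfl⟩⟩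

/-! ### Matrix convexity of the projected lift -/

lemma posSemidef_sum_conj {ι κ : Type} {σ : Type*} [Fintype σ] {M : Matrix ι ι ℂ}
    (hM : M.PosSemidef) (e : κ → σ → ι) (w : κ → σ → ℂ) :
    (Matrix.of fun a b => ∑ k, ∑ l, star (w a k) * M (e a k) (e b l) * w b l).PosSemidef := by
  obtain ⟨H, _, _, _, T, -, hT⟩ := exists_gram hM
  convert posSemidef_inner fun a => ∑ k, w a k • T (Finsupp.single (e a k) 1) using 1
  ext a b
  simp only [Matrix.of_apply, sum_inner]
  refine Finset.sum_congr rfl fun k _ => ?_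
  simp only [inner_sum]
  refine Finset.sum_congr rfl fun l _ => ?_
  rw [inner_smul_left, inner_smul_right, hT, matForm_single, Complex.star_def]
  ring

/-- The cone of moment sequences satisfying the conditions of the lift, without the
normalization `Y_∅ = 1`. -/
def liftCone {g ℓ : ℕ} (p : MatPoly g ℓ ℓ) (n : ℕ) : Set (Word g → Matrix (Fin n) (Fin n) ℂ) :=
  {Y | (∀ α, Y (star α) = (Y α)ᴴ) ∧ (hankel Y).PosSemidef ∧ (localizing p Y).PosSemidef}

lemma mem_lift_iff {g ℓ n : ℕ} {p : MatPoly g ℓ ℓ} {Y : Word g → Matrix (Fin n) (Fin n) ℂ} :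
    Y ∈ lift p n ↔ Y 1 = 1 ∧ Y ∈ liftCone p n :=
  Iff.rfl

lemma add_mem_liftCone {g ℓ n : ℕ} {p : MatPoly g ℓ ℓ} {Y Y' : Word g → Matrix (Fin n) (Fin n) ℂ}
    (hY : Y ∈ liftCone p n) (hY' : Y' ∈ liftCone p n) : Y + Y' ∈ liftCone p n := by
  refine ⟨fun α => ?_, ?_, ?_⟩
  · simp [hY.1, hY'.1]
  · exact hY.2.1.add hY'.2.1
  · convert hY.2.2.add hY'.2.2 using 1
    ext a b
    simp [localizing, Finsupp.sum, mul_add, Finset.sum_add_distrib]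

lemma conj_apply {n m : ℕ} (W : Matrix (Fin n) (Fin m) ℂ) (A : Matrix (Fin n) (Fin n) ℂ)
    (i j : Fin m) : (Wᴴ * A * W) i j = ∑ k, ∑ l, star (W k i) * A k l * W l j := by
  simp only [Matrix.mul_apply, Matrix.conjTranspose_apply, Finset.sum_mul]
  exact Finset.sum_comm

/-- W is arbitrary, since the cone imposes no normalization; this permits the coisometries needed
for direct sums. -/
lemma conj_mem_liftCone {g ℓ n m : ℕ} {p : MatPoly g ℓ ℓ}
    {Y : Word g → Matrix (Fin n) (Fin n) ℂ} (hY : Y ∈ liftCone p n)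
    (W : Matrix (Fin n) (Fin m) ℂ) : (fun α => Wᴴ * Y α * W) ∈ liftCone p m := by
  refine ⟨fun α => ?_, ?_, ?_⟩
  · simp [hY.1, Matrix.mul_assoc]
  · convert posSemidef_sum_conj hY.2.1 (fun (a : Word g × Fin m) k => (a.1, k))
      (fun a k => W k a.2) using 1
    ext a b
    simp [hankel, conj_apply]
  · convert posSemidef_sum_conj hY.2.2 (fun (a : Word g × Fin ℓ × Fin m) k => (a.1, a.2.1, k))
      (fun a k => W k a.2.2) using 1
    ext a b
    simp only [localizing, conj_apply, Matrix.of_apply, Finsupp.sum, Finset.mul_sum, Finset.sum_mul]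
    rw [Finset.sum_comm]
    refine Finset.sum_congr rfl fun k _ => ?_
    rw [Finset.sum_comm]
    refine Finset.sum_congr rfl fun l _ => Finset.sum_congr rfl fun γ _ => ?_
    ring

/-- The coisometry `ℂ^(n+m) → ℂ^n` onto the first summand. -/
def fstCoisometry (n m : ℕ) : Matrix (Fin n) (Fin (n + m)) ℂ :=
  (Matrix.fromCols (1 : Matrix (Fin n) (Fin n) ℂ) (0 : Matrix (Fin n) (Fin m) ℂ)).submatrix id
    finSumFinEquiv.symm

/-- The coisometry `ℂ^(n+m) → ℂ^m` onto the second summand. -/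
def sndCoisometry (n m : ℕ) : Matrix (Fin m) (Fin (n + m)) ℂ :=
  (Matrix.fromCols (0 : Matrix (Fin m) (Fin n) ℂ) (1 : Matrix (Fin m) (Fin m) ℂ)).submatrix id
    finSumFinEquiv.symm

lemma reindex_fromBlocks_eq_conj_add_conj {n m : ℕ} (A : Matrix (Fin n) (Fin n) ℂ)
    (B : Matrix (Fin m) (Fin m) ℂ) :
    Matrix.reindex finSumFinEquiv finSumFinEquiv (Matrix.fromBlocks A 0 0 B) =
      (fstCoisometry n m)ᴴ * A * fstCoisometry n m +
        (sndCoisometry n m)ᴴ * B * sndCoisometry n m := by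
  ext i j
  obtain ⟨i, rfl⟩ := finSumFinEquiv.surjective i
  obtain ⟨j, rfl⟩ := finSumFinEquiv.surjective j
  rw [Matrix.add_apply, conj_apply, conj_apply]
  rcases i with i | i <;> rcases j with j | j <;>
    simp [fstCoisometry, sndCoisometry, Matrix.one_apply, -finSumFinEquiv_apply_left,
      -finSumFinEquiv_apply_right]

/-- A direct sum of moment sequences is a sum of two conjugates by the coordinate coisometries. The
normalization at the empty word is recovered only after adding them. -/
theorem isMatrixConvex_liftHat {g ℓ : ℕ} (p : MatPoly g ℓ ℓ) : IsMatrixConvex (liftHat p) where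
  subset_herm := by
    rintro n _ ⟨Y, hY, rfl⟩ j
    rw [Matrix.IsHermitian, firstMoments, ← hY.2.1, FreeMonoid.star_of]
  directSum_mem := by
    rintro n m _ _ ⟨Y, hY, rfl⟩ ⟨Y', hY', rfl⟩
    refine ⟨_, mem_lift_iff.2 ⟨?_, add_mem_liftCone
      (conj_mem_liftCone (mem_lift_iff.1 hY).2 (fstCoisometry n m))
      (conj_mem_liftCone (mem_lift_iff.1 hY').2 (sndCoisometry n m))⟩, ?_⟩
    · rw [Pi.add_apply, ← reindex_fromBlocks_eq_conj_add_conj, hY.1, hY'.1]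
      simp
    · funext j
      exact (reindex_fromBlocks_eq_conj_add_conj _ _).symm
  conj_mem := by
    rintro n m _ V ⟨Y, hY, rfl⟩ hV
    exact ⟨_, mem_lift_iff.2 ⟨by simp [hY.1, hV], conj_mem_liftCone (mem_lift_iff.1 hY).2 V⟩, rfl⟩

theorem matHull_subset_liftHat {g ℓ : ℕ} (p : MatPoly g ℓ ℓ) (n : ℕ) :
    matHull (semialg p) n ⊆ liftHat p n :=
  fun _ hX => hX _ (isMatrixConvex_liftHat p) (semialg_subset_liftHat p)

end FreeLasserre

end

theorem theorem5p7 {𝓚 : Type*} [NormedAddCommGroup 𝓚] [InnerProductSpace ℂ 𝓚] [CompleteSpace 𝓚]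
    [TopologicalSpace.SeparableSpace 𝓚] (hinf : ¬ FiniteDimensional ℂ 𝓚)
    {g ℓ : ℕ} (p : FreeLasserre.MatPoly g ℓ ℓ)
    (hsymm : FreeLasserre.IsSymmetricPoly p) (harch : FreeLasserre.IsArchimedean p) :
    (∀ n : ℕ, FreeLasserre.operHull 𝓚 p n = FreeLasserre.liftHat p n) ∧
    ∀ n : ℕ, IsClosed (FreeLasserre.operHull 𝓚 p n) ∧
      FreeLasserre.IsBoundedSet (FreeLasserre.operHull 𝓚 p n) ∧
      FreeLasserre.matHull (FreeLasserre.semialg p) n ⊆ FreeLasserre.operHull 𝓚 p n := by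
  have h := FreeLasserre.operHull_eq_liftHat (𝓚 := 𝓚) hinf harch
  refine ⟨h, fun n => ?_⟩
  rw [h n]
  exact ⟨(harch.isCompact_liftHat n).isClosed,
    FreeLasserre.isBoundedSet_of_isCompact (harch.isCompact_liftHat n),
    FreeLasserre.matHull_subset_liftHat p n⟩
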